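/- Let $d\ge 1$ and let $X$ be an integrable random vector in $\mathbb{R}^d$ with mean $\mu=\mathbb{E}[X]$ and an elliptical density with positive definite scatter matrix $\Sigma\in\mathbb{R}^{d\times d}$, that is, a density of the form \[ x\longmapsto C\,\det(\Sigma)^{-1/2}\,g\bigl((x-\mu)^T\Sigma^{-1}(x-\mu)\bigr), \] where $g:[0,\infty)\to[0,\infty)$ is measurable with $\int_0^\infty s^{d/2-1}g(s)\,ds<\infty$ and $C>0$ is the normalization constant. Assume that for every unit vector $u\in\mathbb{R}^d$ the projection $\langle X-\mu,u\rangle$ has a density $\varphi_u$ on $\mathbb{R}$ that is log-concave ($\log\varphi_u$ is concave, where $\log 0=-\infty$ is allowed) and weakly symmetric (its mean is also a median). For a unit vector $u$ and $t\in\mathbb{R}$ put $A_{u,t}=\{x\in\mathbb{R}^d:\langle x-\mu,u\rangle\le t\}$ and \[ F(u,t)=\frac{\bigl\|\mathbb{E}[X\mathbf 1_{A_{u,t}}(X)]\bigr\|^2}{\mathbb{P}(X\in A_{u,t})}+\frac{\bigl\|\mathbb{E}[X\mathbf 1_{A_{u,t}^c}(X)]\bigr\|^2}{\mathbb{P}(X\in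 A_{u,t}^c)}, \] where a term whose event has probability $0$ is read as $0$. Then: (i) For every unit vector $u$, the map $t\mapsto F(u,t)$ attains its maximum over $\mathbb{R}$ at $t=0$. (ii) Let $\lambda_{\max}(\Sigma)$ be the largest eigenvalue of $\Sigma$. A unit vector $u$ maximizes $v\mapsto F(v,0)$ over all unit vectors $v$ if and only if $u$ is an eigenvector of $\Sigma$ for the eigenvalue $\lambda_{\max}(\Sigma)$. -/

import Mathlib

open MeasureTheory Set Module

noncomputable section

/-- A nonnegative function `φ` on `ℝ` is log-concave if `log φ` is concave, with the usual
convention `log 0 = -∞`: the set where `φ` is positive is convex and `log φ` is concave on it. -/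
def IsLogConcave (φ : ℝ → ℝ) : Prop :=
  (∀ x, 0 ≤ φ x) ∧ ConcaveOn ℝ {x | 0 < φ x} (fun x => Real.log (φ x))

/-- `φ` is a density of the measure `ν` with respect to Lebesgue measure on `ℝ`. -/
def IsDensityOf (φ : ℝ → ℝ) (ν : Measure ℝ) : Prop :=
  Measurable φ ∧ (∀ x, 0 ≤ φ x) ∧ ν = volume.withDensity (fun x => ENNReal.ofReal (φ x))

/-- A density on `ℝ` is weakly symmetric if its mean exists and is also a median. -/
def IsWeaklySymmetric (φ : ℝ → ℝ) : Prop :=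
  Integrable (fun x => x * φ x) ∧ ∫ x in Iic (∫ y, y * φ y), φ x = 1 / 2

/-- The law `ν` on `ℝ` has a weakly symmetric log-concave density. -/
def HasWeaklySymmetricLogConcaveDensity (ν : Measure ℝ) : Prop :=
  ∃ φ : ℝ → ℝ, IsDensityOf φ ν ∧ IsLogConcave φ ∧ IsWeaklySymmetric φ

/-- The law `ν` on `ℝ^d` has the elliptical density
`x ↦ C * det(S)^(-1/2) * g ((x - m)ᵀ S⁻¹ (x - m))`
with location `m`, scatter matrix `S`, density generator `g : [0, ∞) → [0, ∞)`
(only the values of `g` on `[0, ∞)` matter) and normalization constant `C`. -/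
def HasEllipticalDensity {d : ℕ} (ν : Measure (EuclideanSpace ℝ (Fin d)))
    (m : EuclideanSpace ℝ (Fin d)) (S : Matrix (Fin d) (Fin d) ℝ) : Prop :=
  ∃ (g : ℝ → ℝ) (C : ℝ), Measurable g ∧ (∀ s, 0 ≤ s → 0 ≤ g s) ∧
    IntegrableOn (fun s : ℝ => s ^ ((d : ℝ) / 2 - 1) * g s) (Ioi 0) ∧ 0 < C ∧
    ν = volume.withDensity (fun x : EuclideanSpace ℝ (Fin d) =>
      ENNReal.ofReal (C * S.det ^ (-(1 / 2) : ℝ) *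
        g ((x - m).ofLp ⬝ᵥ (S⁻¹.mulVec (x - m).ofLp))))

/-- The halfspace `{x | ⟨x - m, u⟩ ≤ t}`. -/
def halfspace {d : ℕ} (m u : EuclideanSpace ℝ (Fin d)) (t : ℝ) :
    Set (EuclideanSpace ℝ (Fin d)) :=
  {x | inner ℝ (x - m) u ≤ t}

/-- The two-regime objective
`‖E[X 1_A(X)]‖² / P(X ∈ A) + ‖E[X 1_{Aᶜ}(X)]‖² / P(X ∈ Aᶜ)` of a set `A`.
A term whose event has probability zero is `0 / 0 = 0`. -/
def regimeObjective {Ω : Type*} [MeasurableSpace Ω] {d : ℕ} (P : Measure Ω)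
    (X : Ω → EuclideanSpace ℝ (Fin d)) (A : Set (EuclideanSpace ℝ (Fin d))) : ℝ :=
  ‖∫ ω in X ⁻¹' A, X ω ∂P‖ ^ 2 / P.real (X ⁻¹' A) +
    ‖∫ ω in X ⁻¹' Aᶜ, X ω ∂P‖ ^ 2 / P.real (X ⁻¹' Aᶜ)

/-- The halfspace functional `F(u, t)`, with halfspaces centered at the mean of `X`. -/
def halfspaceFunctional {Ω : Type*} [MeasurableSpace Ω] {d : ℕ} (P : Measure Ω)
    (X : Ω → EuclideanSpace ℝ (Fin d)) (u : EuclideanSpace ℝ (Fin d)) (t : ℝ) : ℝ :=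
  regimeObjective P X (halfspace (∫ ω, X ω ∂P) u t)

end

/-! Write `X = μ + T Z` with `Z` spherically symmetric and `T T† = Σ`. By the parallel-axis
identity, `F(u, t) - ‖μ‖²` is the squared norm of `E[(X - μ) 1_{⟨X - μ, u⟩ > t}]` divided by the
product of the two probabilities. As `⟨X - μ, u⟩ = ⟨Z, T† u⟩`, reflecting `Z` in the line of `T† u`
shows that this vector is a multiple of `T T† u = Σ u`, whence
`F(u, t) = ‖μ‖² + ‖Σ u‖² / ⟨Σ u, u⟩² * B(t)` with `B` the between-group variance of the projection.

The projection is symmetric about `0`, so `B(-t) = B(t)`, and log-concavity makes its tail `f`,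
normalized by `f(0) = 1`, submultiplicative on `[0, ∞)`. This bounds `∫_t^∞ f` above and `∫_0^t f`
below in terms of `f(t)`, which gives `B(t) ≤ B(0)`.

Finally `B(0)` is the square of the mean absolute value of the projection, which is proportional to
`‖T† u‖ = √⟨Σ u, u⟩`. So `F(u, 0) - ‖μ‖²` is proportional to `‖Σ u‖² / ⟨Σ u, u⟩`, and this quotient
is at most the largest eigenvalue, with equality exactly at its eigenvectors. -/

theorem integrableOn_Ioi_comp_add_right_iff {f : ℝ → ℝ} (a s : ℝ) :
    IntegrableOn (fun x => f (x + s)) (Ioi a) ↔ IntegrableOn f (Ioi (a + s)) := by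
  have h := (measurePreserving_add_right volume s).integrableOn_comp_preimage
    (measurableEmbedding_addRight s) (f := f) (s := Ioi (a + s))
  rwa [preimage_add_const_Ioi, add_sub_cancel_right] at h

theorem setIntegral_Ioi_comp_add_right (f : ℝ → ℝ) (a s : ℝ) :
    ∫ x in Ioi a, f (x + s) = ∫ x in Ioi (a + s), f x := by
  have h := (measurePreserving_add_right volume s).setIntegral_preimage_emb
    (measurableEmbedding_addRight s) f (Ioi (a + s))
  rwa [preimage_add_const_Ioi, add_sub_cancel_right] at h

section Submultiplicative

variable {f : ℝ → ℝ} {t : ℝ}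

theorem setIntegral_Ioi_le_mul_setIntegral_Ioi_zero (hi : IntegrableOn f (Ioi 0))
    (hmul : ∀ x y, 0 ≤ x → 0 ≤ y → f (x + y) ≤ f x * f y) (ht : 0 ≤ t) :
    ∫ x in Ioi t, f x ≤ f t * ∫ x in Ioi 0, f x := by
  have hshift := setIntegral_Ioi_comp_add_right f 0 t
  have hishift := integrableOn_Ioi_comp_add_right_iff (f := f) 0 t
  rw [zero_add] at hshift hishift
  rw [← hshift, ← integral_const_mul]
  refine setIntegral_mono_on (hishift.2 (hi.mono_set (Ioi_subset_Ioi ht))) (hi.const_mul _)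
    measurableSet_Ioi fun x hx => ?_
  rw [add_comm]
  exact hmul t x ht (le_of_lt hx)

theorem mul_sqrt_le_intervalIntegral (hf : ∀ x, 0 ≤ f x) (hi : IntervalIntegrable f volume 0 t)
    (hmul : ∀ x y, 0 ≤ x → 0 ≤ y → f (x + y) ≤ f x * f y) (ht : 0 ≤ t) :
    t * √(f t) ≤ ∫ x in 0..t, f x := by
  have hreflect : ∫ x in 0..t, f (t - x) = ∫ x in 0..t, f x := by simp
  have hi' : IntervalIntegrable (fun x => f (t - x)) volume 0 t := by
    simpa using (hi.comp_sub_left t).symm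
  have hamgm : ∀ x ∈ Icc 0 t, 2 * √(f t) ≤ f x + f (t - x) := by
    intro x hx
    have hft : f t ≤ f x * f (t - x) := by
      simpa using hmul x (t - x) hx.1 (sub_nonneg.2 hx.2)
    nlinarith [Real.sq_sqrt (hf t), sq_nonneg (f x - f (t - x)), hf x, hf (t - x),
      Real.sqrt_nonneg (f t)]
  have hmono := intervalIntegral.integral_mono_on ht intervalIntegrable_const (hi.add hi') hamgm
  rw [intervalIntegral.integral_add hi hi', hreflect, intervalIntegral.integral_const,
    smul_eq_mul] at hmono
  linarith

/-- With `r = √(f t)`, the two bounds above give `t * f t + ∫_t^∞ f ≤ r * (1 + r - r²) * ∫_0^∞ f`,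
and `2 - r² - (1 + r - r²)² = (1 - r²) * (1 - r)²`. -/
theorem sq_mul_add_setIntegral_Ioi_le (hf : ∀ x, 0 ≤ f x) (hi : IntegrableOn f (Ioi 0))
    (hmul : ∀ x y, 0 ≤ x → 0 ≤ y → f (x + y) ≤ f x * f y) (ht : 0 ≤ t) (hft : f t ≤ 1) :
    (t * f t + ∫ x in Ioi t, f x) ^ 2 ≤ f t * (2 - f t) * (∫ x in Ioi 0, f x) ^ 2 := by
  have hsplit := intervalIntegral.integral_interval_add_Ioi hi (hi.mono_set (Ioi_subset_Ioi ht))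
  have hB := setIntegral_Ioi_le_mul_setIntegral_Ioi_zero hi hmul ht
  have hA := mul_sqrt_le_intervalIntegral hf
    ((intervalIntegrable_iff_integrableOn_Ioc_of_le ht).2 (hi.mono_set Ioc_subset_Ioi_self))
    hmul ht
  have hM : 0 ≤ ∫ x in Ioi 0, f x := integral_nonneg hf
  have hB0 : 0 ≤ ∫ x in Ioi t, f x := integral_nonneg hf
  obtain ⟨r, hr0, hr1, hr⟩ : ∃ r, 0 ≤ r ∧ r ≤ 1 ∧ f t = r ^ 2 :=
    ⟨√(f t), Real.sqrt_nonneg _, Real.sqrt_le_one.2 hft, (Real.sq_sqrt (hf t)).symm⟩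
  rw [hr] at hB hA ⊢
  rw [Real.sqrt_sq hr0] at hA
  set A := ∫ x in 0..t, f x
  set B := ∫ x in Ioi t, f x
  set M := ∫ x in Ioi 0, f x
  have hlin : t * r ^ 2 + B ≤ r * (1 + r - r ^ 2) * M := by
    calc t * r ^ 2 + B ≤ r * A + B := by nlinarith
      _ = r * M + (1 - r) * B := by rw [← hsplit]; ring
      _ ≤ r * M + (1 - r) * (r ^ 2 * M) := by
        gcongr
      _ = r * (1 + r - r ^ 2) * M := by ring
  have hpoly : (1 + r - r ^ 2) ^ 2 ≤ 2 - r ^ 2 := by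
    have h : 0 ≤ (1 - r ^ 2) * (1 - r) ^ 2 :=
      mul_nonneg (sub_nonneg.2 (pow_le_one₀ hr0 hr1)) (sq_nonneg _)
    linarith [show 2 - r ^ 2 - (1 + r - r ^ 2) ^ 2 = (1 - r ^ 2) * (1 - r) ^ 2 by ring]
  calc (t * r ^ 2 + B) ^ 2 ≤ (r * (1 + r - r ^ 2) * M) ^ 2 := by gcongr
    _ = r ^ 2 * (1 + r - r ^ 2) ^ 2 * M ^ 2 := by ring
    _ ≤ r ^ 2 * (2 - r ^ 2) * M ^ 2 := by gcongr

end Submultiplicative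

theorem add_le_add_of_concaveOn {s : Set ℝ} {g : ℝ → ℝ} (hg : ConcaveOn ℝ s g) {x y a : ℝ}
    (hx : x ∈ s) (hya : y + a ∈ s) (hxy : x ≤ y) (ha : 0 ≤ a) :
    g x + g (y + a) ≤ g y + g (x + a) := by
  obtain ⟨p, q, hp, hq, hpq, hy⟩ : y ∈ segment ℝ x (y + a) := by
    rw [segment_eq_Icc (by linarith)]
    exact ⟨hxy, by linarith⟩
  have hxa : q • x + p • (y + a) = x + a := by
    simp only [smul_eq_mul] at hy ⊢
    linear_combination (x + y + a) * hpq - hy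
  have hgy := hg.2 hx hya hp hq hpq
  have hgx := hg.2 hx hya hq hp (by rwa [add_comm])
  rw [hy] at hgy
  rw [hxa] at hgx
  calc g x + g (y + a) = (p • g x + q • g (y + a)) + (q • g x + p • g (y + a)) := by
        simp only [smul_eq_mul]
        linear_combination -(g x + g (y + a)) * hpq
    _ ≤ g y + g (x + a) := add_le_add hgy hgx

namespace IsLogConcave

variable {φ : ℝ → ℝ}

theorem mul_le_mul (h : IsLogConcave φ) {x y s : ℝ} (hxy : x ≤ y) (hs : 0 ≤ s) :
    φ x * φ (y + s) ≤ φ y * φ (x + s) := by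
  obtain hx | hx := (h.1 x).eq_or_lt
  · rw [← hx, zero_mul]
    exact mul_nonneg (h.1 _) (h.1 _)
  obtain hys | hys := (h.1 (y + s)).eq_or_lt
  · rw [← hys, mul_zero]
    exact mul_nonneg (h.1 _) (h.1 _)
  have hy : 0 < φ y := h.2.1.ordConnected.out hx hys ⟨hxy, by linarith⟩
  have hxs : 0 < φ (x + s) := h.2.1.ordConnected.out hx hys ⟨by linarith, by linarith⟩
  rw [← Real.log_le_log_iff (mul_pos hx hys) (mul_pos hy hxs), Real.log_mul hx.ne' hys.ne',
    Real.log_mul hy.ne' hxs.ne']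
  exact add_le_add_of_concaveOn h.2 hx hys hxy hs

theorem mul_setIntegral_Ioi_le (h : IsLogConcave φ) (hi : Integrable φ) {x y s : ℝ} (hxy : x ≤ y)
    (hs : 0 ≤ s) : φ x * ∫ z in Ioi (y + s), φ z ≤ φ (x + s) * ∫ z in Ioi y, φ z := by
  rw [← setIntegral_Ioi_comp_add_right, ← integral_const_mul, ← integral_const_mul]
  refine setIntegral_mono_on ((hi.comp_add_right s).const_mul _).integrableOn
    (hi.const_mul _).integrableOn measurableSet_Ioi fun z hz => ?_
  rw [mul_comm (φ (x + s))]
  exact h.mul_le_mul (hxy.trans (le_of_lt hz)) hs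

theorem setIntegral_Ioi_mul_le (h : IsLogConcave φ) (hi : Integrable φ) {x y s : ℝ} (hxy : x ≤ y)
    (hs : 0 ≤ s) :
    (∫ z in Ioi x, φ z) * ∫ z in Ioi (y + s), φ z ≤
      (∫ z in Ioi y, φ z) * ∫ z in Ioi (x + s), φ z := by
  have hsplit : ∀ {a b : ℝ}, (∫ z in a..b, φ z) + ∫ z in Ioi b, φ z = ∫ z in Ioi a, φ z :=
    intervalIntegral.integral_interval_add_Ioi hi.integrableOn hi.integrableOn
  have hslice : (∫ z in x..y, φ z) * ∫ z in Ioi (y + s), φ z ≤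
      (∫ z in x..y, φ (z + s)) * ∫ z in Ioi y, φ z := by
    rw [← intervalIntegral.integral_mul_const, ← intervalIntegral.integral_mul_const]
    exact intervalIntegral.integral_mono_on hxy (hi.intervalIntegrable.mul_const _)
      ((hi.comp_add_right s).intervalIntegrable.mul_const _)
      fun z hz => h.mul_setIntegral_Ioi_le hi hz.2 hs
  rw [intervalIntegral.integral_comp_add_right φ s] at hslice
  rw [← hsplit (a := x) (b := y), ← hsplit (a := x + s) (b := y + s)]
  linarith

end IsLogConcave

namespace IsDensityOf

variable {φ : ℝ → ℝ} {ν : Measure ℝ}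

theorem integrable [IsFiniteMeasure ν] (h : IsDensityOf φ ν) : Integrable φ := by
  refine ⟨h.1.aestronglyMeasurable, ?_⟩
  rw [hasFiniteIntegral_iff_ofReal (.of_forall h.2.1), ← setLIntegral_univ,
    ← withDensity_apply _ .univ, ← h.2.2]
  exact measure_lt_top ν univ

theorem measureReal_eq_setIntegral (h : IsDensityOf φ ν) {s : Set ℝ} (hs : MeasurableSet s) :
    ν.real s = ∫ x in s, φ x := by
  rw [integral_eq_lintegral_of_nonneg_ae (.of_forall h.2.1) h.1.aestronglyMeasurable,
    ← withDensity_apply _ hs, ← h.2.2, measureReal_def]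

theorem nullSingletonClass (h : IsDensityOf φ ν) : NullSingletonClass ν := by
  rw [h.2.2]
  infer_instance

theorem measureReal_Ioi_mul_le [IsFiniteMeasure ν] (h : IsDensityOf φ ν) (hφ : IsLogConcave φ)
    {x y s : ℝ} (hxy : x ≤ y) (hs : 0 ≤ s) :
    ν.real (Ioi x) * ν.real (Ioi (y + s)) ≤ ν.real (Ioi y) * ν.real (Ioi (x + s)) := by
  simp only [h.measureReal_eq_setIntegral measurableSet_Ioi]
  exact hφ.setIntegral_Ioi_mul_le h.integrable hxy hs

end IsDensityOf

section Tail

variable {ν : Measure ℝ} [IsFiniteMeasure ν]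

theorem integrableOn_measureReal_Ioi (hi : Integrable (fun x : ℝ => x) ν) :
    IntegrableOn (fun s => ν.real (Ioi s)) (Ioi 0) := by
  have hanti : Antitone fun s => ν.real (Ioi s) :=
    fun s t hst => measureReal_mono (Ioi_subset_Ioi hst)
  have hlayer := lintegral_eq_lintegral_meas_lt ν (.of_forall fun x => abs_nonneg x)
    hi.abs.aemeasurable
  refine ⟨hanti.measurable.aestronglyMeasurable, ?_⟩
  rw [hasFiniteIntegral_iff_ofReal (.of_forall fun _ => measureReal_nonneg)]
  calc ∫⁻ s in Ioi 0, ENNReal.ofReal (ν.real (Ioi s))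
      ≤ ∫⁻ s in Ioi 0, ν {x | s < |x|} := by
        refine lintegral_mono fun s => ?_
        rw [ofReal_measureReal]
        exact measure_mono fun x hx => lt_of_lt_of_le hx (le_abs_self x)
    _ = ∫⁻ x, ENNReal.ofReal |x| ∂ν := hlayer.symm
    _ < ⊤ := hi.abs.lintegral_lt_top

theorem setIntegral_Ioi_id_eq (hi : Integrable (fun x : ℝ => x) ν) (t : ℝ) :
    ∫ x in Ioi t, x ∂ν = t * ν.real (Ioi t) + ∫ s in Ioi t, ν.real (Ioi s) := by
  have hlayer : ∫ x in Ioi t, (x - t) ∂ν = ∫ s in Ioi t, ν.real (Ioi s) := by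
    have hnonneg : 0 ≤ᵐ[ν.restrict (Ioi t)] fun x => x - t := by
      filter_upwards [ae_restrict_mem measurableSet_Ioi] with x hx
      exact sub_nonneg.2 (le_of_lt hx)
    have hshift := setIntegral_Ioi_comp_add_right (fun s => ν.real (Ioi s)) 0 t
    rw [zero_add] at hshift
    have hit : IntegrableOn (fun x => x - t) (Ioi t) ν :=
      (hi.sub (integrable_const t)).integrableOn
    rw [hit.integral_eq_integral_meas_lt hnonneg, ← hshift]
    refine setIntegral_congr_fun measurableSet_Ioi fun s hs => ?_
    have hset : {x | s < x - t} = Ioi (s + t) := by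
      ext x
      simp only [mem_ofPred_eq, mem_Ioi, lt_sub_iff_add_lt]
    have hst : t ≤ s + t := le_add_of_nonneg_left (le_of_lt hs)
    simp only [hset, measureReal_restrict_apply measurableSet_Ioi, Ioi_inter_Ioi,
      sup_of_le_left hst]
  rw [integral_sub hi.integrableOn (integrable_const t).integrableOn, setIntegral_const,
    smul_eq_mul] at hlayer
  linarith

end Tail

/-- The between-group variance of a law `ν` on `ℝ` of mean zero, split at `t`: the part of the
variance of `ν` explained by the side of `t`. With mean zero the two halves of the integral of `x`
are opposite, so that only the upper one appears. If one side is null the value is `x / 0 = 0`. -/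
noncomputable def betweenVariance (ν : Measure ℝ) (t : ℝ) : ℝ :=
  (∫ x in Ioi t, x ∂ν) ^ 2 / (ν.real (Ioi t) * ν.real (Iic t))

section BetweenVariance

variable {ν : Measure ℝ}

theorem measureReal_Iic_eq_one_sub [IsProbabilityMeasure ν] (t : ℝ) :
    ν.real (Iic t) = 1 - ν.real (Ioi t) := by
  rw [← compl_Ioi, probReal_compl_eq_one_sub measurableSet_Ioi]

theorem betweenVariance_le_of_nonneg [IsProbabilityMeasure ν]
    (hi : Integrable (fun x : ℝ => x) ν) (hmed : ν.real (Ioi 0) = 1 / 2)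
    (htail : ∀ x y, 0 ≤ x → 0 ≤ y →
      ν.real (Ioi 0) * ν.real (Ioi (x + y)) ≤ ν.real (Ioi x) * ν.real (Ioi y))
    {t : ℝ} (ht : 0 ≤ t) : betweenVariance ν t ≤ betweenVariance ν 0 := by
  have hle : ν.real (Ioi t) ≤ 1 / 2 := hmed ▸ measureReal_mono (Ioi_subset_Ioi ht)
  have hkey := sq_mul_add_setIntegral_Ioi_le (f := fun s => 2 * ν.real (Ioi s))
    (fun s => by positivity) ((integrableOn_measureReal_Ioi hi).const_mul 2)
    (fun x y hx hy => by linarith [hmed ▸ htail x y hx hy]) ht (by linarith)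
  have h0 := setIntegral_Ioi_id_eq hi 0
  rw [zero_mul, zero_add] at h0
  rw [integral_const_mul, integral_const_mul, ← h0] at hkey
  rw [betweenVariance, betweenVariance, measureReal_Iic_eq_one_sub, measureReal_Iic_eq_one_sub,
    hmed, setIntegral_Ioi_id_eq hi t]
  refine div_le_of_le_mul₀ (mul_nonneg measureReal_nonneg (by linarith)) (by positivity) ?_
  linear_combination hkey / 4

theorem integral_abs_pos [NeZero ν] [NullSingletonClass ν]
    (hi : Integrable (fun x : ℝ => x) ν) : 0 < ∫ x, |x| ∂ν := by
  have hsupp : Function.support (fun x : ℝ => |x|) = {0}ᶜ := by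
    ext x
    exact abs_ne_zero
  rw [integral_pos_iff_support_of_nonneg (fun x => abs_nonneg x) hi.abs, hsupp,
    measure_congr (ae_eq_univ.2 (by rw [compl_compl, measure_singleton]))]
  exact Measure.measure_univ_pos.2 (NeZero.ne ν)

variable [ν.IsNegInvariant]

theorem integral_id_eq_zero_of_isNegInvariant (ν : Measure ℝ) [ν.IsNegInvariant] :
    ∫ x, x ∂ν = 0 := by
  have h := integral_neg_eq_self (fun x : ℝ => x) ν
  rw [integral_neg] at h
  linarith

theorem setIntegral_Iic_id_eq_neg (hi : Integrable (fun x : ℝ => x) ν) (t : ℝ) :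
    ∫ x in Iic t, x ∂ν = -∫ x in Ioi t, x ∂ν := by
  have h := integral_add_compl (measurableSet_Iic (a := t)) hi
  rw [integral_id_eq_zero_of_isNegInvariant ν, compl_Iic] at h
  linarith

theorem integral_abs_eq_two_mul (hi : Integrable (fun x : ℝ => x) ν) :
    ∫ x, |x| ∂ν = 2 * ∫ x in Ioi 0, x ∂ν := by
  have hpos : ∫ x in Ioi 0, |x| ∂ν = ∫ x in Ioi 0, x ∂ν :=
    setIntegral_congr_fun measurableSet_Ioi fun x hx => abs_of_pos hx
  have hneg : ∫ x in Iic 0, |x| ∂ν = -∫ x in Iic 0, x ∂ν := by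
    rw [← integral_neg]
    exact setIntegral_congr_fun measurableSet_Iic fun x hx => abs_of_nonpos hx
  rw [← integral_add_compl measurableSet_Ioi hi.abs, compl_Ioi, hpos, hneg,
    setIntegral_Iic_id_eq_neg hi]
  ring

variable [NullSingletonClass ν]

theorem measureReal_Ioi_neg (t : ℝ) : ν.real (Ioi (-t)) = ν.real (Iic t) := by
  rw [← neg_Iio, measureReal_def, Measure.measure_neg, measure_congr Iio_ae_eq_Iic,
    measureReal_def]

theorem measureReal_Ioi_zero [IsProbabilityMeasure ν] : ν.real (Ioi 0) = 1 / 2 := by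
  have h := measureReal_Ioi_neg (ν := ν) 0
  rw [neg_zero, measureReal_Iic_eq_one_sub] at h
  linarith

theorem setIntegral_Ioi_neg_id (hi : Integrable (fun x : ℝ => x) ν) (t : ℝ) :
    ∫ x in Ioi (-t), x ∂ν = ∫ x in Ioi t, x ∂ν := by
  have h := (Measure.measurePreserving_neg ν).setIntegral_preimage_emb
    (MeasurableEquiv.neg ℝ).measurableEmbedding (fun x => x) (Ioi (-t))
  rw [← h, integral_neg, neg_preimage, neg_Ioi, neg_neg, setIntegral_congr_set Iio_ae_eq_Iic,
    setIntegral_Iic_id_eq_neg hi, neg_neg]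

theorem betweenVariance_neg (hi : Integrable (fun x : ℝ => x) ν) (t : ℝ) :
    betweenVariance ν (-t) = betweenVariance ν t := by
  rw [betweenVariance, betweenVariance, setIntegral_Ioi_neg_id hi, ← measureReal_Ioi_neg (-t),
    measureReal_Ioi_neg t, neg_neg, mul_comm]

variable [IsProbabilityMeasure ν]

theorem betweenVariance_zero (hi : Integrable (fun x : ℝ => x) ν) :
    betweenVariance ν 0 = (∫ x, |x| ∂ν) ^ 2 := by
  rw [betweenVariance, measureReal_Iic_eq_one_sub, measureReal_Ioi_zero,
    integral_abs_eq_two_mul hi]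
  ring

theorem betweenVariance_le_zero (hi : Integrable (fun x : ℝ => x) ν)
    (htail : ∀ x y, 0 ≤ x → 0 ≤ y →
      ν.real (Ioi 0) * ν.real (Ioi (x + y)) ≤ ν.real (Ioi x) * ν.real (Ioi y))
    (t : ℝ) : betweenVariance ν t ≤ betweenVariance ν 0 := by
  obtain ht | ht := le_total 0 t
  · exact betweenVariance_le_of_nonneg hi measureReal_Ioi_zero htail ht
  · rw [← betweenVariance_neg hi]
    exact betweenVariance_le_of_nonneg hi measureReal_Ioi_zero htail (neg_nonneg.2 ht)

end BetweenVariance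

section Spectral

variable {E : Type*} [NormedAddCommGroup E] [InnerProductSpace ℝ E] {L : E →ₗ[ℝ] E} {lam : ℝ}

theorem inner_map_smul_sub_map_le (hL : L.IsSymmetric)
    (hlam : ∀ x, inner ℝ (L x) x ≤ lam * ‖x‖ ^ 2) (x : E) :
    inner ℝ (L (lam • x - L x)) (lam • x - L x) ≤
      lam * (lam * inner ℝ (L x) x - ‖L x‖ ^ 2) := by
  have hsymm : inner ℝ (L (L x)) x = ‖L x‖ ^ 2 := by rw [hL, real_inner_self_eq_norm_sq]
  simp only [map_sub, map_smul, inner_sub_left, inner_sub_right, real_inner_smul_left,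
    real_inner_smul_right, real_inner_self_eq_norm_sq, hsymm]
  linarith [hlam (L x)]

/-- The quadratic form of `L` at `lam • x - L x` is nonnegative, and zero only if this vanishes. -/
theorem sq_norm_map_le_and_eq_iff (hL : L.IsSymmetric)
    (hpos : ∀ x, x ≠ 0 → 0 < inner ℝ (L x) x)
    (hlam : ∀ x, inner ℝ (L x) x ≤ lam * ‖x‖ ^ 2) {x : E} (hx : x ≠ 0) :
    ‖L x‖ ^ 2 / inner ℝ (L x) x ≤ lam ∧
      (‖L x‖ ^ 2 / inner ℝ (L x) x = lam ↔ L x = lam • x) := by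
  have hgap := inner_map_smul_sub_map_le hL hlam x
  have hlam0 : 0 < lam := pos_of_mul_pos_left ((hpos x hx).trans_le (hlam x)) (sq_nonneg _)
  have hform : ∀ y, 0 ≤ inner ℝ (L y) y := fun y => by
    obtain rfl | hy := eq_or_ne y 0
    · simp
    · exact (hpos y hy).le
  rw [div_le_iff₀ (hpos x hx), div_eq_iff (hpos x hx).ne']
  refine ⟨sub_nonneg.1 (nonneg_of_mul_nonneg_right ((hform _).trans hgap) hlam0), fun h => ?_,
    fun h => ?_⟩
  · by_contra hne
    have := hpos _ (sub_ne_zero.2 (Ne.symm hne))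
    rw [h, sub_self, mul_zero] at hgap
    exact this.not_ge hgap
  · rw [h, real_inner_smul_left, real_inner_self_eq_norm_sq, norm_smul, mul_pow, Real.norm_eq_abs,
      sq_abs]
    ring

variable [FiniteDimensional ℝ E] [Nontrivial E]

theorem exists_isGreatest_eigenvalue_forall_inner_le (hL : L.IsSymmetric) :
    ∃ lam : ℝ, IsGreatest {r : ℝ | End.HasEigenvalue L r} lam ∧
      ∀ x, inner ℝ (L x) x ≤ lam * ‖x‖ ^ 2 := by
  have hbdd : BddAbove (range fun x : { x : E // x ≠ 0 } => inner ℝ (L x) x / ‖(x : E)‖ ^ 2) := by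
    refine ⟨‖L.toContinuousLinearMap‖, ?_⟩
    rintro _ ⟨x, rfl⟩
    exact (le_abs_self _).trans (L.toContinuousLinearMap.rayleighQuotient_le_norm x)
  have hle : ∀ x, inner ℝ (L x) x ≤
      (⨆ x : { x : E // x ≠ 0 }, inner ℝ (L x) x / ‖(x : E)‖ ^ 2 : ℝ) * ‖x‖ ^ 2 := by
    intro x
    obtain rfl | hx := eq_or_ne x 0
    · simp
    · rw [← div_le_iff₀ (by positivity)]
      exact le_ciSup hbdd ⟨x, hx⟩
  refine ⟨_, ⟨hL.hasEigenvalue_iSup_of_finiteDimensional, fun r hr => ?_⟩, hle⟩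
  obtain ⟨x, hx⟩ := End.HasEigenvalue.exists_hasEigenvector hr
  have h := hle x
  rw [hx.apply_eq_smul, real_inner_smul_left, real_inner_self_eq_norm_sq] at h
  exact le_of_mul_le_mul_right h (pow_pos (norm_pos_iff.2 hx.2) 2)

theorem exists_isGreatest_eigenvalue_forall_maximizer_iff (hL : L.IsSymmetric)
    (hpos : ∀ x, x ≠ 0 → 0 < inner ℝ (L x) x) :
    ∃ lam : ℝ, IsGreatest {r : ℝ | End.HasEigenvalue L r} lam ∧
      ∀ u : E, ‖u‖ = 1 →
        ((∀ v : E, ‖v‖ = 1 → ‖L v‖ ^ 2 / inner ℝ (L v) v ≤ ‖L u‖ ^ 2 / inner ℝ (L u) u) ↔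
          End.HasEigenvector L lam u) := by
  obtain ⟨lam, hgreatest, hlam⟩ := exists_isGreatest_eigenvalue_forall_inner_le hL
  have hunit : ∀ {v : E}, ‖v‖ = 1 → v ≠ 0 := fun hv => norm_ne_zero_iff.1 (hv ▸ one_ne_zero)
  refine ⟨lam, hgreatest, fun u hu => ?_⟩
  obtain ⟨hle, heq⟩ := sq_norm_map_le_and_eq_iff hL hpos hlam (hunit hu)
  rw [End.hasEigenvector_iff, End.mem_eigenspace_iff, ← heq, and_iff_left (hunit hu)]
  refine ⟨fun hmax => hle.antisymm ?_, fun h v hv => ?_⟩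
  · obtain ⟨w, hw⟩ := hgreatest.1.exists_hasEigenvector
    have hw' : L (‖w‖⁻¹ • w) = lam • ‖w‖⁻¹ • w := by
      rw [map_smul, hw.apply_eq_smul, smul_comm]
    have hnorm : ‖‖w‖⁻¹ • w‖ = 1 := norm_smul_inv_norm hw.2
    rw [← (sq_norm_map_le_and_eq_iff hL hpos hlam (hunit hnorm)).2.2 hw']
    exact hmax _ hnorm
  · rw [h]
    exact (sq_norm_map_le_and_eq_iff hL hpos hlam (hunit hv)).1

end Spectral

/-- A measure on an inner product space is spherically symmetric if it is invariant under all
linear isometric automorphisms. The elliptically symmetric laws are the affine images of such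
measures. -/
def IsSphericallySymmetric {F : Type*} [NormedAddCommGroup F] [InnerProductSpace ℝ F]
    [MeasurableSpace F] (σ : Measure F) : Prop :=
  ∀ R : F ≃ₗᵢ[ℝ] F, σ.map R = σ

theorem map_withDensity_comp {α β : Type*} [MeasurableSpace α] [MeasurableSpace β]
    {m : Measure α} {T : α → β} (hT : Measurable T) {f : β → ENNReal} (hf : Measurable f) :
    (m.withDensity fun x => f (T x)).map T = (m.map T).withDensity f := by
  ext s hs
  rw [Measure.map_apply hT hs, withDensity_apply _ (hT hs), withDensity_apply _ hs,
    setLIntegral_map hs hf hT]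

theorem isSphericallySymmetric_volume {F : Type*} [NormedAddCommGroup F] [InnerProductSpace ℝ F]
    [FiniteDimensional ℝ F] [MeasurableSpace F] [BorelSpace F] :
    IsSphericallySymmetric (volume : Measure F) :=
  fun R => R.measurePreserving.map_eq

namespace IsSphericallySymmetric

variable {F : Type*} [NormedAddCommGroup F] [InnerProductSpace ℝ F] [MeasurableSpace F]
  {σ : Measure F}

theorem smul (hσ : IsSphericallySymmetric σ) (c : ENNReal) : IsSphericallySymmetric (c • σ) :=
  fun R => by rw [Measure.map_smul, hσ R]

variable [BorelSpace F]

theorem withDensity_comp_norm (hσ : IsSphericallySymmetric σ) {h : ℝ → ENNReal}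
    (hh : Measurable h) : IsSphericallySymmetric (σ.withDensity fun z => h ‖z‖) := fun R => by
  have hR := map_withDensity_comp (m := σ) R.continuous.measurable (f := fun z => h ‖z‖)
    (by fun_prop)
  simpa only [R.norm_map, hσ R] using hR

theorem setIntegral_eq_smul [CompleteSpace F] (hσ : IsSphericallySymmetric σ)
    (hi : Integrable (fun z => z) σ) (w : F) {s : Set ℝ} (hs : MeasurableSet s) :
    ∫ z in {z | inner ℝ z w ∈ s}, z ∂σ =
      ((∫ x in s, x ∂σ.map fun z => inner ℝ z w) / ‖w‖ ^ 2) • w := by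
  set A : Set F := {z | inner ℝ z w ∈ s}
  have hfix : (ℝ ∙ w).reflection w = w :=
    Submodule.reflection_mem_subspace_eq_self (Submodule.mem_span_singleton_self w)
  have hinv : (ℝ ∙ w).reflection ⁻¹' A = A := by
    ext z
    have h := (ℝ ∙ w).reflection.inner_map_map z w
    rw [hfix] at h
    simp only [A, mem_preimage, mem_ofPred_eq, h]
  have hmem : ∫ z in A, z ∂σ ∈ ℝ ∙ w := by
    have hR : MeasurePreserving (ℝ ∙ w).reflection σ σ :=
      ⟨(ℝ ∙ w).reflection.continuous.measurable, hσ _⟩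
    have h := hR.setIntegral_preimage_emb
      (ℝ ∙ w).reflection.toHomeomorph.measurableEmbedding (fun z => z) A
    rw [hinv] at h
    rw [← Submodule.reflection_eq_self_iff]
    exact ((ℝ ∙ w).reflection.toContinuousLinearEquiv.integral_comp_comm fun z => z).symm.trans h
  obtain ⟨c, hc⟩ := Submodule.mem_span_singleton.1 hmem
  have hcoord : ∫ x in s, x ∂σ.map (fun z => inner ℝ z w) = c * ‖w‖ ^ 2 := by
    rw [setIntegral_map (f := fun x : ℝ => x) hs (by fun_prop) (by fun_prop)]
    calc ∫ z in A, inner ℝ z w ∂σ = inner ℝ (∫ z in A, z ∂σ) w := by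
          simp only [real_inner_comm w]
          exact integral_inner hi.integrableOn w
      _ = c * ‖w‖ ^ 2 := by rw [← hc, real_inner_smul_left, real_inner_self_eq_norm_sq]
  obtain rfl | hw := eq_or_ne w 0
  · rw [← hc, smul_zero, smul_zero]
  · rw [← hc, hcoord, mul_div_cancel_right₀ _ (pow_ne_zero 2 (norm_ne_zero_iff.2 hw))]

theorem integral_eq_zero [CompleteSpace F] (hσ : IsSphericallySymmetric σ)
    (hi : Integrable (fun z => z) σ) : ∫ z, z ∂σ = 0 := by
  simpa using hσ.setIntegral_eq_smul hi 0 .univ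

theorem map_inner_eq_of_norm_eq (hσ : IsSphericallySymmetric σ) {v w : F} (h : ‖v‖ = ‖w‖) :
    σ.map (fun z => inner ℝ z v) = σ.map fun z => inner ℝ z w := by
  set R := (ℝ ∙ (v - w))ᗮ.reflection
  have hcomp : (fun z => inner ℝ z v) = (fun z => inner ℝ z w) ∘ R := by
    ext z
    rw [Function.comp_apply, ← Submodule.reflection_sub h, R.inner_map_map]
  rw [hcomp, ← Measure.map_map (by fun_prop) R.continuous.measurable, hσ R]

theorem isNegInvariant_map_inner (hσ : IsSphericallySymmetric σ) (w : F) :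
    (σ.map fun z => inner ℝ z w).IsNegInvariant := by
  refine ⟨?_⟩
  rw [Measure.neg, Measure.map_map measurable_neg (by fun_prop),
    ← hσ.map_inner_eq_of_norm_eq (norm_neg w)]
  simp only [inner_neg_right]
  rfl

theorem exists_integral_abs_inner_eq [Nontrivial F] (hσ : IsSphericallySymmetric σ) :
    ∃ κ : ℝ, ∀ w, ∫ x, |x| ∂σ.map (fun z => inner ℝ z w) = κ * ‖w‖ := by
  obtain ⟨e, he⟩ := exists_norm_eq F zero_le_one
  refine ⟨∫ x, |x| ∂σ.map (fun z => inner ℝ z e), fun w => ?_⟩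
  rw [hσ.map_inner_eq_of_norm_eq (v := w) (w := ‖w‖ • e) (by simp [norm_smul, he])]
  rw [integral_map (by fun_prop) (by fun_prop), integral_map (by fun_prop) (by fun_prop)]
  simp only [real_inner_smul_right, abs_mul, abs_norm, integral_const_mul]
  rw [mul_comm]

end IsSphericallySymmetric

/-- A law `ρ` is elliptically symmetric with location `m` and scatter operator `L` if it is the law
of `m + T Z` for a spherically symmetric `Z` and an invertible `T` with `T T† = L`. No density is
required: the uniform law on the surface of an ellipsoid is an example. -/
def IsEllipticallySymmetric {E : Type*} [NormedAddCommGroup E] [InnerProductSpace ℝ E]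
    [CompleteSpace E] [MeasurableSpace E] (ρ : Measure E) (m : E) (L : E →ₗ[ℝ] E) : Prop :=
  ∃ (σ : Measure E) (T : E ≃L[ℝ] E), IsSphericallySymmetric σ ∧
    (∀ u, T (ContinuousLinearMap.adjoint (T : E →L[ℝ] E) u) = L u) ∧ ρ = σ.map fun z => m + T z

open scoped MatrixOrder in
theorem exists_continuousLinearEquiv_apply_adjoint_eq {d : ℕ} {S : Matrix (Fin d) (Fin d) ℝ}
    (hS : S.PosDef) : ∃ T : EuclideanSpace ℝ (Fin d) ≃L[ℝ] EuclideanSpace ℝ (Fin d),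
      ∀ u, T (ContinuousLinearMap.adjoint (T : EuclideanSpace ℝ (Fin d) →L[ℝ] _) u) =
        Matrix.toEuclideanLin S u := by
  obtain ⟨B, hB, rfl⟩ := CStarAlgebra.isStrictlyPositive_iff_eq_mul_star_self.1
    hS.isStrictlyPositive
  have hdet := (Matrix.isUnit_iff_isUnit_det B).1 hB
  have hleft : Matrix.toEuclideanLin B⁻¹ ∘ₗ Matrix.toEuclideanLin B = LinearMap.id := by
    rw [← Matrix.toLpLin_mul_same, Matrix.nonsing_inv_mul _ hdet, Matrix.toLpLin_one]
  have hright : Matrix.toEuclideanLin B ∘ₗ Matrix.toEuclideanLin B⁻¹ = LinearMap.id := by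
    rw [← Matrix.toLpLin_mul_same, Matrix.mul_nonsing_inv _ hdet, Matrix.toLpLin_one]
  set T := LinearEquiv.ofLinearMap _ _ hright hleft
  refine ⟨T.toContinuousLinearEquiv, fun u => ?_⟩
  have hadj : ContinuousLinearMap.adjoint (T.toContinuousLinearEquiv :
      EuclideanSpace ℝ (Fin d) →L[ℝ] _) u = Matrix.toEuclideanLin B.conjTranspose u := by
    rw [Matrix.toEuclideanLin_conjTranspose_eq_adjoint]
    rfl
  rw [hadj, Matrix.star_eq_conjTranspose, Matrix.toLpLin_mul_same]
  rfl

theorem dotProduct_inv_mulVec_eq_sq_norm {d : ℕ} {S : Matrix (Fin d) (Fin d) ℝ} (hS : IsUnit S)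
    {T : EuclideanSpace ℝ (Fin d) ≃L[ℝ] EuclideanSpace ℝ (Fin d)}
    (hT : ∀ u, T (ContinuousLinearMap.adjoint (T : EuclideanSpace ℝ (Fin d) →L[ℝ] _) u) =
      Matrix.toEuclideanLin S u) (z : EuclideanSpace ℝ (Fin d)) :
    (T z).ofLp ⬝ᵥ S⁻¹.mulVec (T z).ofLp = ‖z‖ ^ 2 := by
  have hS' : S * S⁻¹ = 1 := S.mul_nonsing_inv ((Matrix.isUnit_iff_isUnit_det S).1 hS)
  set x := Matrix.toEuclideanLin S⁻¹ (T z)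
  have hSx : Matrix.toEuclideanLin S x = T z := by
    rw [← LinearMap.comp_apply, ← Matrix.toLpLin_mul_same, hS', Matrix.toLpLin_one,
      LinearMap.id_apply]
  have hadj : ContinuousLinearMap.adjoint (T : EuclideanSpace ℝ (Fin d) →L[ℝ] _) x = z :=
    T.injective ((hT x).trans hSx)
  calc (T z).ofLp ⬝ᵥ S⁻¹.mulVec (T z).ofLp = inner ℝ x (T z) := by
        rw [EuclideanSpace.inner_eq_star_dotProduct, star_trivial]
        rfl
    _ = inner ℝ (ContinuousLinearMap.adjoint (T : EuclideanSpace ℝ (Fin d) →L[ℝ] _) x) z :=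
        (ContinuousLinearMap.adjoint_inner_left (T : EuclideanSpace ℝ (Fin d) →L[ℝ] _) z x).symm
    _ = ‖z‖ ^ 2 := by rw [hadj, real_inner_self_eq_norm_sq]

theorem HasEllipticalDensity.isEllipticallySymmetric {d : ℕ}
    {ρ : Measure (EuclideanSpace ℝ (Fin d))} {m : EuclideanSpace ℝ (Fin d)}
    {S : Matrix (Fin d) (Fin d) ℝ} (h : HasEllipticalDensity ρ m S) (hS : S.PosDef) :
    IsEllipticallySymmetric ρ m (Matrix.toEuclideanLin S) := by
  obtain ⟨g, C, hg, -, -, -, hρ⟩ := h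
  obtain ⟨T, hT⟩ := exists_continuousLinearEquiv_apply_adjoint_eq hS
  set Φ : EuclideanSpace ℝ (Fin d) → EuclideanSpace ℝ (Fin d) := fun x => T.symm (x - m)
  have hΦ : Measurable Φ := by fun_prop
  set h : ℝ → ENNReal := fun r => ENNReal.ofReal (C * S.det ^ (-(1 / 2) : ℝ) * g (r ^ 2))
  have hh : Measurable h := by fun_prop
  have hρΦ : ρ = volume.withDensity fun x => h ‖Φ x‖ := by
    rw [hρ]
    congr with x
    have hq := dotProduct_inv_mulVec_eq_sq_norm hS.isUnit hT (Φ x)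
    rw [T.apply_symm_apply] at hq
    rw [hq]
  obtain ⟨c, hvol⟩ : ∃ c : ENNReal, (volume : Measure (EuclideanSpace ℝ (Fin d))).map Φ =
      c • volume := by
    have hcomp : Φ = T.symm ∘ fun x => x - m := rfl
    rw [hcomp, ← Measure.map_map (by fun_prop) (by fun_prop), map_sub_right_eq_self]
    obtain ⟨c, -, hc⟩ := T.symm.toLinearEquiv.toLinearMap.exists_map_addHaar_eq_smul_addHaar
      volume volume T.symm.surjective
    exact ⟨c, hc⟩
  refine ⟨ρ.map Φ, T, ?_, hT, ?_⟩
  · rw [hρΦ, map_withDensity_comp (f := fun z => h ‖z‖) hΦ (by fun_prop), hvol]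
    exact (isSphericallySymmetric_volume.smul c).withDensity_comp_norm hh
  · rw [Measure.map_map (by fun_prop) hΦ]
    simp [Φ, Function.comp_def]

theorem sq_norm_add_smul_div_add_sq_norm_smul_sub_div {F : Type*} [NormedAddCommGroup F]
    [InnerProductSpace ℝ F] {p q : ℝ} (hpq : p + q = 1) {w : F} (hw : p * q = 0 → w = 0) (m : F) :
    ‖p • m + w‖ ^ 2 / p + ‖q • m - w‖ ^ 2 / q = ‖m‖ ^ 2 + ‖w‖ ^ 2 / (p * q) := by
  obtain rfl : q = 1 - p := eq_sub_of_add_eq' hpq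
  obtain h | h := eq_or_ne (p * (1 - p)) 0
  · rw [hw h, h]
    obtain rfl | h := mul_eq_zero.1 h
    · simp
    · obtain rfl : p = 1 := (sub_eq_zero.1 h).symm
      simp
  · obtain ⟨hp, hq⟩ := mul_ne_zero_iff.1 h
    rw [norm_add_sq_real, norm_sub_sq_real]
    simp only [norm_smul, real_inner_smul_left, mul_pow, Real.norm_eq_abs, sq_abs]
    field_simp
    ring

section RegimeObjective

variable {Ω : Type*} [MeasurableSpace Ω] {P : Measure Ω} {d : ℕ}
  {X : Ω → EuclideanSpace ℝ (Fin d)}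

theorem measurableSet_halfspace (m u : EuclideanSpace ℝ (Fin d)) (t : ℝ) :
    MeasurableSet (halfspace m u t) :=
  measurableSet_le (by fun_prop) measurable_const

theorem regimeObjective_map_id (hX : AEMeasurable X P) {A : Set (EuclideanSpace ℝ (Fin d))}
    (hA : MeasurableSet A) : regimeObjective (P.map X) id A = regimeObjective P X A := by
  have hint : ∀ {B : Set (EuclideanSpace ℝ (Fin d))}, MeasurableSet B →
      ∫ x in B, id x ∂P.map X = ∫ ω in X ⁻¹' B, X ω ∂P := fun hB =>
    setIntegral_map hB measurable_id.aestronglyMeasurable hX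
  rw [regimeObjective, regimeObjective, preimage_id, preimage_id, hint hA, hint hA.compl,
    map_measureReal_apply_of_aemeasurable hX hA,
    map_measureReal_apply_of_aemeasurable hX hA.compl]

theorem halfspaceFunctional_map_id (hX : AEMeasurable X P) (u : EuclideanSpace ℝ (Fin d)) (t : ℝ) :
    halfspaceFunctional (P.map X) id u t = halfspaceFunctional P X u t := by
  rw [halfspaceFunctional, integral_map hX measurable_id.aestronglyMeasurable,
    regimeObjective_map_id hX (measurableSet_halfspace _ _ _)]
  rfl

theorem regimeObjective_eq_sq_norm_add [IsProbabilityMeasure P] (hXi : Integrable X P)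
    {A : Set (EuclideanSpace ℝ (Fin d))} (hA : MeasurableSet A) :
    regimeObjective P X A = ‖∫ ω, X ω ∂P‖ ^ 2 +
      ‖∫ ω in X ⁻¹' Aᶜ, (X ω - ∫ ω', X ω' ∂P) ∂P‖ ^ 2 /
        (P.real (X ⁻¹' Aᶜ) * P.real (X ⁻¹' A)) := by
  set m := ∫ ω, X ω ∂P
  set w := ∫ ω in X ⁻¹' Aᶜ, (X ω - m) ∂P
  have hXA : NullMeasurableSet (X ⁻¹' A) P := hXi.aemeasurable.nullMeasurableSet_preimage hA
  have hprob : P.real (X ⁻¹' Aᶜ) + P.real (X ⁻¹' A) = 1 := by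
    rw [preimage_compl, add_comm, measureReal_add_measureReal_compl₀ hXA, probReal_univ]
  have hcompl : ∫ ω in X ⁻¹' Aᶜ, X ω ∂P = P.real (X ⁻¹' Aᶜ) • m + w := by
    have hsub := integral_sub (hXi.integrableOn (s := X ⁻¹' Aᶜ)) (integrable_const m)
    rw [setIntegral_const] at hsub
    rw [← sub_eq_iff_eq_add', ← hsub]
  have hself : ∫ ω in X ⁻¹' A, X ω ∂P = P.real (X ⁻¹' A) • m - w := by
    have hsum : _ = m := integral_add_compl₀ hXA hXi
    rw [← preimage_compl, hcompl] at hsum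
    rw [eq_sub_of_add_eq hsum, ← sub_sub, eq_sub_of_add_eq' hprob, sub_smul, one_smul]
  have hzero : P.real (X ⁻¹' Aᶜ) * P.real (X ⁻¹' A) = 0 → w = 0 := by
    intro h
    obtain h | h := mul_eq_zero.1 h
    · exact setIntegral_measure_zero _ ((measureReal_eq_zero_iff).1 h)
    · rw [h, zero_smul, zero_sub,
        setIntegral_measure_zero _ ((measureReal_eq_zero_iff).1 h)] at hself
      exact neg_eq_zero.1 hself.symm
  rw [regimeObjective, hself, hcompl, add_comm,
    sq_norm_add_smul_div_add_sq_norm_smul_sub_div hprob hzero]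

end RegimeObjective

theorem IsSphericallySymmetric.halfspaceFunctional_eq {d : ℕ}
    {σ : Measure (EuclideanSpace ℝ (Fin d))} [IsProbabilityMeasure σ]
    (hσ : IsSphericallySymmetric σ) (hi : Integrable (fun z => z) σ)
    (T : EuclideanSpace ℝ (Fin d) →L[ℝ] EuclideanSpace ℝ (Fin d))
    (m u : EuclideanSpace ℝ (Fin d)) (t : ℝ) :
    halfspaceFunctional σ (fun z => m + T z) u t = ‖m‖ ^ 2 +
      (‖T (T.adjoint u)‖ / ‖T.adjoint u‖ ^ 2) ^ 2 *
        betweenVariance (σ.map fun z => inner ℝ z (T.adjoint u)) t := by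
  have hTi : Integrable (fun z => m + T z) σ := (integrable_const m).add (T.integrable_comp hi)
  have hmean : ∫ z, m + T z ∂σ = m := by
    rw [integral_add (integrable_const m) (T.integrable_comp hi), T.integral_comp_comm hi,
      hσ.integral_eq_zero hi]
    simp
  have hpre : (fun z => m + T z) ⁻¹' halfspace m u t =
      (fun z => inner ℝ z (T.adjoint u)) ⁻¹' Iic t := by
    ext z
    simp only [halfspace, mem_preimage, mem_ofPred_eq, mem_Iic, add_sub_cancel_left,
      T.adjoint_inner_right]
  have hint : ∫ z in (fun z => inner ℝ z (T.adjoint u)) ⁻¹' Ioi t, T z ∂σ =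
      ((∫ x in Ioi t, x ∂σ.map fun z => inner ℝ z (T.adjoint u)) / ‖T.adjoint u‖ ^ 2) •
        T (T.adjoint u) := by
    rw [T.integral_comp_comm hi.integrableOn, ← map_smul]
    exact congrArg T (hσ.setIntegral_eq_smul hi _ measurableSet_Ioi)
  rw [halfspaceFunctional, hmean,
    regimeObjective_eq_sq_norm_add hTi (measurableSet_halfspace m u t), hmean, preimage_compl,
    hpre, ← preimage_compl, compl_Iic]
  simp only [add_sub_cancel_left]
  rw [hint, betweenVariance, map_measureReal_apply (by fun_prop) measurableSet_Ioi,
    map_measureReal_apply (by fun_prop) measurableSet_Iic, norm_smul, Real.norm_eq_abs, mul_pow,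
    sq_abs]
  ring

theorem inner_apply_adjoint_self {E : Type*} [NormedAddCommGroup E] [InnerProductSpace ℝ E]
    [CompleteSpace E] (T : E →L[ℝ] E) (u : E) :
    inner ℝ (T (T.adjoint u)) u = ‖T.adjoint u‖ ^ 2 := by
  rw [← T.adjoint_inner_right, real_inner_self_eq_norm_sq]

theorem map_inner_sub_map_add {E : Type*} [NormedAddCommGroup E] [InnerProductSpace ℝ E]
    [CompleteSpace E] [MeasurableSpace E] [BorelSpace E] (σ : Measure E) (m : E) (T : E →L[ℝ] E)
    (u : E) : (σ.map fun z => m + T z).map (fun x => inner ℝ (x - m) u) =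
      σ.map fun z => inner ℝ z (T.adjoint u) := by
  rw [Measure.map_map (by fun_prop) (by fun_prop)]
  simp only [Function.comp_def, add_sub_cancel_left, T.adjoint_inner_right]

theorem integrable_map_inner_sub {E : Type*} [NormedAddCommGroup E] [InnerProductSpace ℝ E]
    [MeasurableSpace E] [BorelSpace E] {ρ : Measure E} [IsFiniteMeasure ρ]
    (hi : Integrable (fun x => x) ρ) (m u : E) :
    Integrable (fun x => x) (ρ.map fun x => inner ℝ (x - m) u) := by
  rw [integrable_map_measure (by fun_prop) (by fun_prop)]
  exact (hi.sub (integrable_const m)).inner_const u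

namespace IsEllipticallySymmetric

section InnerProductSpace

variable {E : Type*} [NormedAddCommGroup E] [InnerProductSpace ℝ E] [CompleteSpace E]
  [MeasurableSpace E] {ρ : Measure E} {m : E} {L : E →ₗ[ℝ] E}

theorem isSymmetric (h : IsEllipticallySymmetric ρ m L) : L.IsSymmetric := by
  obtain ⟨σ, T, -, hT, -⟩ := h
  intro x y
  rw [← hT, ← hT]
  exact (ContinuousLinearMap.adjoint_inner_right (T : E →L[ℝ] E) _ _).symm.trans
    (ContinuousLinearMap.adjoint_inner_left (T : E →L[ℝ] E) _ _)

theorem inner_map_self_pos (h : IsEllipticallySymmetric ρ m L) {x : E} (hx : x ≠ 0) :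
    0 < inner ℝ (L x) x := by
  obtain ⟨σ, T, -, hT, -⟩ := h
  have hadj : (T : E →L[ℝ] E).adjoint x ≠ 0 := fun h0 => hx <| by
    have hinner := ContinuousLinearMap.adjoint_inner_left (T : E →L[ℝ] E) (T.symm x) x
    rw [h0, inner_zero_left, ContinuousLinearEquiv.coe_coe, T.apply_symm_apply] at hinner
    exact inner_self_eq_zero.1 hinner.symm
  have hform := inner_apply_adjoint_self (T : E →L[ℝ] E) x
  rw [ContinuousLinearEquiv.coe_coe, hT] at hform
  rw [hform]
  exact pow_pos (norm_pos_iff.2 hadj) 2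

variable [BorelSpace E]

theorem isNegInvariant_map_inner_sub (h : IsEllipticallySymmetric ρ m L) (u : E) :
    (ρ.map fun x => inner ℝ (x - m) u).IsNegInvariant := by
  obtain ⟨σ, T, hσ, -, rfl⟩ := h
  have hproj := map_inner_sub_map_add σ m T u
  exact hproj ▸ hσ.isNegInvariant_map_inner _

theorem exists_integral_abs_inner_sub_eq [Nontrivial E] (h : IsEllipticallySymmetric ρ m L) :
    ∃ κ : ℝ, ∀ u, ∫ x, |x| ∂ρ.map (fun x => inner ℝ (x - m) u) = κ * √(inner ℝ (L u) u) := by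
  obtain ⟨σ, T, hσ, hT, rfl⟩ := h
  obtain ⟨κ, hκ⟩ := hσ.exists_integral_abs_inner_eq
  refine ⟨κ, fun u => ?_⟩
  have hproj := map_inner_sub_map_add σ m T u
  have hform := inner_apply_adjoint_self (T : E →L[ℝ] E) u
  rw [ContinuousLinearEquiv.coe_coe] at hproj hform
  rw [hproj, hκ, ← hT, hform, Real.sqrt_sq (norm_nonneg _)]

end InnerProductSpace

section EuclideanSpace

variable {d : ℕ} {ρ : Measure (EuclideanSpace ℝ (Fin d))} [IsProbabilityMeasure ρ]
  {m : EuclideanSpace ℝ (Fin d)} {L : EuclideanSpace ℝ (Fin d) →ₗ[ℝ] EuclideanSpace ℝ (Fin d)}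

theorem halfspaceFunctional_eq (h : IsEllipticallySymmetric ρ m L)
    (hi : Integrable (fun x => x) ρ) (u : EuclideanSpace ℝ (Fin d)) (t : ℝ) :
    halfspaceFunctional ρ id u t = ‖m‖ ^ 2 + (‖L u‖ / inner ℝ (L u) u) ^ 2 *
      betweenVariance (ρ.map fun x => inner ℝ (x - m) u) t := by
  obtain ⟨σ, T, hσ, hT, rfl⟩ := h
  have hΦ : Measurable fun z => m + T z := by fun_prop
  have hσp : IsProbabilityMeasure σ := Measure.isProbabilityMeasure_of_map fun z => m + T z
  have hiσ : Integrable (fun z => z) σ := by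
    have hTi := (integrable_map_measure (by fun_prop) hΦ.aemeasurable).1 hi
    have hsymm := T.symm.toContinuousLinearMap.integrable_comp (hTi.sub (integrable_const m))
    simpa [Function.comp_def] using hsymm
  have hform := inner_apply_adjoint_self T.toContinuousLinearMap u
  have hproj := map_inner_sub_map_add σ m T u
  have hF := hσ.halfspaceFunctional_eq hiσ T m u t
  rw [ContinuousLinearEquiv.coe_coe] at hform hproj hF
  rw [halfspaceFunctional_map_id hΦ.aemeasurable, hF, hproj, ← hT, hform]

theorem halfspaceFunctional_le_zero (h : IsEllipticallySymmetric ρ m L)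
    (hi : Integrable (fun x => x) ρ) {u : EuclideanSpace ℝ (Fin d)} {φ : ℝ → ℝ}
    (hφ : IsDensityOf φ (ρ.map fun x => inner ℝ (x - m) u)) (hlog : IsLogConcave φ) (t : ℝ) :
    halfspaceFunctional ρ id u t ≤ halfspaceFunctional ρ id u 0 := by
  have hneg := h.isNegInvariant_map_inner_sub u
  have hnull := hφ.nullSingletonClass
  have hprob : IsProbabilityMeasure (ρ.map fun x => inner ℝ (x - m) u) :=
    Measure.isProbabilityMeasure_map (by fun_prop)
  rw [h.halfspaceFunctional_eq hi, h.halfspaceFunctional_eq hi]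
  gcongr
  refine betweenVariance_le_zero (integrable_map_inner_sub hi m u) (fun x y hx hy => ?_) t
  simpa using hφ.measureReal_Ioi_mul_le hlog hx hy

theorem exists_halfspaceFunctional_zero_eq [Nontrivial (EuclideanSpace ℝ (Fin d))]
    (h : IsEllipticallySymmetric ρ m L) (hi : Integrable (fun x => x) ρ)
    (hnull : ∀ u : EuclideanSpace ℝ (Fin d), ‖u‖ = 1 →
      NullSingletonClass (ρ.map fun x => inner ℝ (x - m) u)) :
    ∃ c : ℝ, 0 < c ∧ ∀ u : EuclideanSpace ℝ (Fin d), ‖u‖ = 1 →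
      halfspaceFunctional ρ id u 0 = ‖m‖ ^ 2 + c * (‖L u‖ ^ 2 / inner ℝ (L u) u) := by
  obtain ⟨κ, hκ⟩ := h.exists_integral_abs_inner_sub_eq
  obtain ⟨e, he⟩ := exists_norm_eq (EuclideanSpace ℝ (Fin d)) zero_le_one
  have hprob : ∀ u, IsProbabilityMeasure (ρ.map fun x => inner ℝ (x - m) u) := fun u =>
    Measure.isProbabilityMeasure_map (by fun_prop)
  have hκ0 : κ ≠ 0 := by
    have := hnull e he
    have habs := integral_abs_pos (integrable_map_inner_sub hi m e)
    rw [hκ] at habs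
    exact left_ne_zero_of_mul habs.ne'
  refine ⟨κ ^ 2, by positivity, fun u hu => ?_⟩
  have := hnull u hu
  have := h.isNegInvariant_map_inner_sub u
  have hLu := h.inner_map_self_pos (norm_ne_zero_iff.1 (hu ▸ one_ne_zero))
  rw [h.halfspaceFunctional_eq hi, betweenVariance_zero (integrable_map_inner_sub hi m u), hκ,
    mul_pow, Real.sq_sqrt hLu.le]
  field_simp

end EuclideanSpace

end IsEllipticallySymmetric

theorem theorem2_general {Ω : Type*} [MeasurableSpace Ω] (P : Measure Ω) [IsProbabilityMeasure P]
    {d : ℕ} (hd : 1 ≤ d) (X : Ω → EuclideanSpace ℝ (Fin d)) (m : EuclideanSpace ℝ (Fin d))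
    (hXi : Integrable X P) (L : EuclideanSpace ℝ (Fin d) →ₗ[ℝ] EuclideanSpace ℝ (Fin d))
    (hell : IsEllipticallySymmetric (P.map X) m L)
    (hproj : ∀ u : EuclideanSpace ℝ (Fin d), ‖u‖ = 1 →
      ∃ φ, IsDensityOf φ (P.map (fun ω => inner ℝ (X ω - m) u)) ∧ IsLogConcave φ) :
    (∀ u : EuclideanSpace ℝ (Fin d), ‖u‖ = 1 →
      ∀ t : ℝ, halfspaceFunctional P X u t ≤ halfspaceFunctional P X u 0) ∧
    (∃ lam : ℝ, IsGreatest {r : ℝ | End.HasEigenvalue L r} lam ∧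
      ∀ u : EuclideanSpace ℝ (Fin d), ‖u‖ = 1 →
        ((∀ v : EuclideanSpace ℝ (Fin d), ‖v‖ = 1 →
            halfspaceFunctional P X v 0 ≤ halfspaceFunctional P X u 0) ↔
          End.HasEigenvector L lam u)) := by
  have hX := hXi.aemeasurable
  have : NeZero d := ⟨by lia⟩
  have hprob : IsProbabilityMeasure (P.map X) := Measure.isProbabilityMeasure_map hX
  have hi : Integrable (fun x => x) (P.map X) :=
    (integrable_map_measure measurable_id.aestronglyMeasurable hX).2 hXi
  have hlaw : ∀ u, P.map (fun ω => inner ℝ (X ω - m) u) =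
      (P.map X).map fun x => inner ℝ (x - m) u := fun u =>
    (AEMeasurable.map_map_of_aemeasurable (g := fun x => inner ℝ (x - m) u) (by fun_prop) hX).symm
  simp only [← halfspaceFunctional_map_id hX, hlaw] at hproj ⊢
  refine ⟨fun u hu t => ?_, ?_⟩
  · obtain ⟨φ, hφ, hlog⟩ := hproj u hu
    exact hell.halfspaceFunctional_le_zero hi hφ hlog t
  obtain ⟨c, hc, hF⟩ := hell.exists_halfspaceFunctional_zero_eq hi fun u hu =>
    let ⟨_, hφ, _⟩ := hproj u hu
    hφ.nullSingletonClass
  obtain ⟨lam, hlam, hiff⟩ := exists_isGreatest_eigenvalue_forall_maximizer_iff hell.isSymmetric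
    fun _ => hell.inner_map_self_pos
  refine ⟨lam, hlam, fun u hu => (forall₂_congr fun v hv => ?_).trans (hiff u hu)⟩
  rw [hF u hu, hF v hv, add_le_add_iff_left, mul_le_mul_iff_right₀ hc]

theorem theorem2 {Ω : Type*} [MeasurableSpace Ω] (P : Measure Ω) [IsProbabilityMeasure P]
    {d : ℕ} (hd : 1 ≤ d) (X : Ω → EuclideanSpace ℝ (Fin d)) (hXm : Measurable X)
    (μ : EuclideanSpace ℝ (Fin d)) (hXi : Integrable X P) (hXμ : ∫ ω, X ω ∂P = μ)
    (S : Matrix (Fin d) (Fin d) ℝ) (hS : S.PosDef)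
    (hell : HasEllipticalDensity (P.map X) μ S)
    (hproj : ∀ u : EuclideanSpace ℝ (Fin d), ‖u‖ = 1 →
      HasWeaklySymmetricLogConcaveDensity (P.map (fun ω => inner ℝ (X ω - μ) u))) :
    (∀ u : EuclideanSpace ℝ (Fin d), ‖u‖ = 1 →
      ∀ t : ℝ, halfspaceFunctional P X u t ≤ halfspaceFunctional P X u 0) ∧
    (∃ lam : ℝ, IsGreatest {r : ℝ | End.HasEigenvalue (Matrix.toEuclideanLin S) r} lam ∧
      ∀ u : EuclideanSpace ℝ (Fin d), ‖u‖ = 1 →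
        ((∀ v : EuclideanSpace ℝ (Fin d), ‖v‖ = 1 →
            halfspaceFunctional P X v 0 ≤ halfspaceFunctional P X u 0) ↔
          End.HasEigenvector (Matrix.toEuclideanLin S) lam u)) :=
  theorem2_general P hd X μ hXi _ (hell.isEllipticallySymmetric hS) fun u hu =>
    let ⟨φ, hφ, hlog, _⟩ := hproj u hu
    ⟨φ, hφ, hlog⟩
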